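/- Let $b\ge 2$ be an integer and let $W(j_1,\dots,j_n)$, for $n\ge 1$ and $j_1,\dots,j_n\in\{0,\dots,b-1\}$, be independent random variables, each equal to $b$ with probability $1/b$ and to $0$ with probability $1-1/b$ (the totally critical weight). For $n\ge 1$ let $$Y_n = b^{-n}\sum_{j_1,\dots,j_n\in\{0,\dots,b-1\}} W(j_1)\,W(j_1,j_2)\cdots W(j_1,j_2,\dots,j_n)$$ be the associated Mandelbrot cascade martingale. Then for every real $q>1$ the moments $\mathbb{E}[Y_n^q]$ are finite and $$\lim_{n\to\infty}\frac{\log \mathbb{E}[Y_n^q]}{\log n} = q-1 .$$ -/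

import Mathlib

open MeasureTheory ProbabilityTheory Filter Topology

/-- The `b`-adic words `(j₁, …, jₙ)`, `n ≥ 1`, with letters in `{0, …, b - 1}`.
The pair `⟨k, j⟩` is the word `j` of length `k + 1`; there is no empty word. -/
abbrev BWord (b : ℕ) : Type := Σ k : ℕ, (Fin (k + 1) → Fin b)

/-- For a word `j = (j₁, …, jₙ)` and `k < n`, its prefix `(j₁, …, j_{k+1})`. -/
def wordPrefix {b n : ℕ} (j : Fin n → Fin b) (k : Fin n) : BWord b :=
  ⟨k, fun i => j (Fin.castLE k.isLt i)⟩

/-- The law of the totally critical weight: `b` with probability `1 / b`,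
and `0` with probability `1 - 1 / b`. -/
noncomputable def totallyCriticalLaw (b : ℕ) : Measure ℝ :=
  ENNReal.ofReal ((b : ℝ)⁻¹) • Measure.dirac (b : ℝ) +
    ENNReal.ofReal (1 - (b : ℝ)⁻¹) • Measure.dirac (0 : ℝ)

/-- The total mass of the Mandelbrot cascade at level `n`:
`Yₙ = b⁻ⁿ ∑_{j₁, …, jₙ} W(j₁) W(j₁, j₂) ⋯ W(j₁, …, jₙ)`. -/
noncomputable def cascadeMass {Ω : Type*} (b : ℕ) (W : BWord b → Ω → ℝ) (n : ℕ) (ω : Ω) : ℝ :=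
  ((b : ℝ) ^ n)⁻¹ * ∑ j : Fin n → Fin b, ∏ k : Fin n, W (wordPrefix j k) ω

/-! Each product of weights is `0` or `b ^ n`, so `Yₙ` counts the surviving words of length `n`: it
is a critical Galton–Watson process with Binomial(b, 1/b) offspring, whose generating function is
`genStep b`. It survives to time `n` with probability of order `1/n` and then has size of order `n`,
so its `q`-th moment is of order `n ^ (q - 1)`. Upper bound: at `t = 1/(8n)` the exponential moment
is at most `1 + 4t` (`iterate_genStep_exp_le`), and `y ^ q` is dominated by `exp y - 1`. Lower
bound: the mean is `1` while survival has probability at most `b ^ 2 / n` (`iterate_genStep_zero`),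
so the mass is forced to be large on survival. -/

/-- One step of the recursion satisfied by the generating functions of the cascade. -/
noncomputable def genStep (b : ℕ) (x : ℝ) : ℝ := (1 + (x - 1) / b) ^ b

/-! ### Iterates of the generating function near its fixed point 1 -/

lemma genStep_le_of_one_le {b : ℕ} (hb : 2 ≤ b) {x : ℝ} (hx : 1 ≤ x) (hx2 : x ≤ 2) :
    1 ≤ genStep b x ∧ genStep b x ≤ x + (x - 1) ^ 2 := by
  have hb0 : (0 : ℝ) < b := by positivity
  have h0 : 0 ≤ (x - 1) / b := div_nonneg (by linarith) hb0.le
  refine ⟨one_le_pow₀ (by linarith), ?_⟩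
  calc genStep b x ≤ (Real.exp ((x - 1) / b)) ^ b := by
        unfold genStep
        gcongr
        linarith [Real.add_one_le_exp ((x - 1) / b)]
    _ = Real.exp (x - 1) := by
        rw [← Real.exp_nat_mul]; congr 1; field_simp
    _ ≤ x + (x - 1) ^ 2 := by
        have := Real.abs_exp_sub_one_sub_id_le (x := x - 1) (by rw [abs_le]; constructor <;> linarith)
        linarith [(abs_le.1 this).2]

/-- While the iterate stays below `1 + 4t`, one step adds at most `(4t)²`; over `n` steps this
totals at most `16nt² ≤ 2t`. -/
lemma iterate_genStep_exp_le {b : ℕ} (hb : 2 ≤ b) {t : ℝ} {n : ℕ} (ht : 0 ≤ t)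
    (htn : 8 * (n * t) ≤ 1) (ht1 : 8 * t ≤ 1) :
    (genStep b)^[n] (Real.exp t) ≤ 1 + 4 * t := by
  suffices H : ∀ m ≤ n, 1 ≤ (genStep b)^[m] (Real.exp t) ∧
      (genStep b)^[m] (Real.exp t) ≤ 1 + 2 * t + 16 * t ^ 2 * m by
    have := (H n le_rfl).2
    nlinarith
  intro m
  induction m with
  | zero =>
    intro _
    have := Real.abs_exp_sub_one_sub_id_le (x := t) (by rw [abs_le]; constructor <;> linarith)
    refine ⟨by simpa using ht, ?_⟩
    simp only [Function.iterate_zero, id_eq, Nat.cast_zero]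
    nlinarith [(abs_le.1 this).2]
  | succ m ih =>
    intro hm
    obtain ⟨h1, h2⟩ := ih (by omega)
    have hmn : (m : ℝ) * t ≤ n * t := by gcongr; omega
    have h3 : (genStep b)^[m] (Real.exp t) ≤ 1 + 4 * t := by nlinarith
    rw [Function.iterate_succ_apply']
    obtain ⟨h4, h5⟩ := genStep_le_of_one_le hb h1 (by linarith)
    refine ⟨h4, h5.trans ?_⟩
    push_cast
    nlinarith

/-- The quadratic gain over Bernoulli's inequality is what makes the survival probability decay. -/
lemma one_sub_mul_add_sq_le_pow {b : ℕ} (hb : 2 ≤ b) {x : ℝ} (h1 : x ≤ 1) :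
    1 - b * x + x ^ 2 ≤ (1 - x) ^ b := by
  induction b, hb using Nat.le_induction with
  | base => norm_num; nlinarith
  | succ k hk ih =>
    have hk' : (2 : ℝ) ≤ k := by exact_mod_cast hk
    rw [pow_succ (1 - x)]
    have := mul_le_mul_of_nonneg_right ih (by linarith : 0 ≤ 1 - x)
    push_cast
    nlinarith [mul_nonneg (sq_nonneg x) (by linarith : 0 ≤ k - x)]

/-- The survival probability `s` satisfies `s' ≤ s - s²/b²`, so `1/s` grows by at least `1/b²` per
step; the bound is this fact with denominators cleared. -/
lemma iterate_genStep_zero {b : ℕ} (hb : 2 ≤ b) (n : ℕ) :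
    0 ≤ (genStep b)^[n] 0 ∧ (genStep b)^[n] 0 ≤ 1 ∧
      (1 - (genStep b)^[n] 0) * (n + b ^ 2) ≤ b ^ 2 := by
  have hb' : (2 : ℝ) ≤ b := by exact_mod_cast hb
  induction n with
  | zero => simp
  | succ n ih =>
    rw [Function.iterate_succ_apply']
    set x := (genStep b)^[n] 0
    obtain ⟨h0, h1, h2⟩ := ih
    have hx0 : 0 ≤ (1 - x) / b := div_nonneg (by linarith) (by linarith)
    have hx1 : (1 - x) / b ≤ 1 := by rw [div_le_one (by linarith)]; linarith
    have e : genStep b x = (1 - (1 - x) / b) ^ b := by unfold genStep; ring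
    have key := one_sub_mul_add_sq_le_pow hb hx1
    rw [← e] at key
    refine ⟨by rw [e]; exact pow_nonneg (by linarith) _,
      by rw [e]; exact pow_le_one₀ (by linarith) (by linarith), ?_⟩
    set p := (1 - x) / b with hp
    have hxp : 1 - x = b * p := by rw [hp]; field_simp
    have h3 : 1 - genStep b x ≤ b * p - p ^ 2 := by linarith
    rw [hxp] at h2
    push_cast
    have h4 : (b * p - p ^ 2) * (n + b ^ 2) ≤ b ^ 2 - b * p := by
      have : (b * p - p ^ 2) * ((n : ℝ) + b ^ 2) = (b * p * (n + b ^ 2)) * (1 - p / b) := by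
        field_simp
      rw [this]
      have hpb : p / b ≤ 1 := by rw [div_le_one (by linarith)]; linarith
      calc _ ≤ (b : ℝ) ^ 2 * (1 - p / b) := by gcongr
        _ = _ := by field_simp
    calc (1 - genStep b x) * ((n : ℝ) + 1 + b ^ 2)
        ≤ (b * p - p ^ 2) * ((n : ℝ) + 1 + b ^ 2) := by gcongr
      _ ≤ (b : ℝ) ^ 2 := by nlinarith [sq_nonneg p]

/-! ### Pointwise inequalities and logarithmic asymptotics -/

lemma exists_rpow_le_mul_exp_sub_one {q : ℝ} (hq : 1 ≤ q) :
    ∃ C > 0, ∀ y ≥ 0, y ^ q ≤ C * (Real.exp y - 1) := by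
  set k := ⌈q⌉₊
  have hk : (1 : ℝ) ≤ k.factorial := by exact_mod_cast k.factorial_pos
  -- The factor 2 absorbs the `-1`: for `y ≥ 1`, `exp y ≥ 2` gives `exp y ≤ 2 * (exp y - 1)`.
  refine ⟨2 * k.factorial, by positivity, fun y hy => ?_⟩
  have he := Real.add_one_le_exp y
  rcases le_total y 1 with h | h
  · calc y ^ q ≤ y ^ (1 : ℝ) := Real.rpow_le_rpow_of_exponent_ge' hy h zero_le_one hq
      _ = y := Real.rpow_one y
      _ ≤ _ := by nlinarith
  · have h2 := Real.pow_div_factorial_le_exp y hy k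
    rw [div_le_iff₀ (by positivity)] at h2
    calc y ^ q ≤ y ^ (k : ℝ) := Real.rpow_le_rpow_of_exponent_le h (Nat.le_ceil q)
      _ = y ^ k := Real.rpow_natCast y k
      _ ≤ _ := by nlinarith

/-- Since `0 ^ 0 = 1`, the factor `1 - 0 ^ y` is the indicator of `y > 0`. Values below `l` are
charged to it, larger ones to `y ^ q`. -/
lemma le_rpow_add_mul_one_sub_zero_rpow {q : ℝ} (hq : 1 ≤ q) {l y : ℝ} (hl : 0 < l) (hy : 0 ≤ y) :
    y ≤ l ^ (1 - q) * y ^ q + l * (1 - (0 : ℝ) ^ y) := by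
  rcases hy.eq_or_lt with rfl | hy'
  · rw [Real.rpow_zero, Real.zero_rpow (by linarith)]; simp
  rw [Real.zero_rpow hy'.ne']
  rcases le_total y l with h | h
  · have : 0 ≤ l ^ (1 - q) * y ^ q := by positivity
    linarith
  · have : y = y ^ (1 - q) * y ^ q := by rw [← Real.rpow_add hy']; simp
    have h2 : y ^ (1 - q) ≤ l ^ (1 - q) := Real.rpow_le_rpow_of_nonpos hl h (by linarith)
    have h3 := mul_le_mul_of_nonneg_right h2 (Real.rpow_nonneg hy q)
    linarith

lemma tendsto_log_div_log {u : ℕ → ℝ} {c C a : ℝ} (hc : 0 < c)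
    (hl : ∀ n : ℕ, 1 ≤ n → c * (n : ℝ) ^ a ≤ u n)
    (hu : ∀ n : ℕ, 1 ≤ n → u n ≤ C * (n : ℝ) ^ a) :
    Tendsto (fun n : ℕ => Real.log (u n) / Real.log n) atTop (𝓝 a) := by
  have hlog : Tendsto (fun n : ℕ => Real.log n) atTop atTop :=
    Real.tendsto_log_atTop.comp tendsto_natCast_atTop_atTop
  have hC : 0 < C := by
    have := (hl 1 le_rfl).trans (hu 1 le_rfl)
    simp at this; linarith
  have aux (d : ℝ) : Tendsto (fun n : ℕ => Real.log d / Real.log n + a) atTop (𝓝 a) := by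
    simpa using (hlog.const_div_atTop (Real.log d)).add_const a
  have eq {d : ℝ} (hd : 0 < d) {n : ℕ} (hn : 2 ≤ n) :
      Real.log d / Real.log n + a = Real.log (d * (n : ℝ) ^ a) / Real.log n := by
    have hn' : (0 : ℝ) < n := by positivity
    have : 0 < Real.log n := Real.log_pos (by exact_mod_cast hn)
    rw [Real.log_mul hd.ne' (by positivity), Real.log_rpow hn']
    field_simp
  refine tendsto_of_tendsto_of_tendsto_of_le_of_le' (aux c) (aux C) ?_ ?_ <;>
  · filter_upwards [eventually_ge_atTop 2] with n hn
    have hn' : (0 : ℝ) < n := by positivity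
    have : 0 < Real.log n := Real.log_pos (by exact_mod_cast hn)
    have h1 : 0 < c * (n : ℝ) ^ a := by positivity
    have h2 := hl n (by omega)
    first
    | rw [eq hc hn]; gcongr
    | rw [eq hC hn]; gcongr; exacts [h1.trans_le h2, hu n (by omega)]

/-! ### Tree structure, first-letter decomposition and independence -/

/-- Random variables indexed by pairs that are independent may be grouped into independent
families. -/
lemma ProbabilityTheory.iIndepFun.curry {Ω ι κ 𝓧 : Type*} [MeasurableSpace Ω] {P : Measure Ω}
    [MeasurableSpace 𝓧] {X : ι → κ → Ω → 𝓧} (mX : ∀ i j, Measurable (X i j))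
    (h : iIndepFun (fun (p : ι × κ) ω => X p.1 p.2 ω) P) :
    iIndepFun (fun i ω j => X i j ω) P := by
  have := h.isProbabilityMeasure
  have hprob (i : ι) (j : κ) : IsProbabilityMeasure (P.map (X i j)) :=
    Measure.isProbabilityMeasure_map (mX i j).aemeasurable
  have hrow (i : ι) : P.map (fun ω j => X i j ω) = Measure.infinitePi fun j => P.map (X i j) :=
    (iIndepFun_iff_map_fun_eq_infinitePi_map (mX i)).1
      (h.precomp (g := fun j => (i, j)) (Prod.mk_right_injective i))
  have h' := (iIndepFun_iff_map_fun_eq_infinitePi_map (by fun_prop)).1 h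
  rw [iIndepFun_iff_map_fun_eq_infinitePi_map (by fun_prop)]
  simp_rw [hrow]
  rw [← Measure.infinitePi_map_curry (fun i j => P.map (X i j)), ← h',
    Measure.map_map (by fun_prop) (by fun_prop)]
  rfl

/-- The word `j` with the letter `i` put in front of it. -/
def consWord {b : ℕ} (i : Fin b) (v : BWord b) : BWord b := ⟨v.1 + 1, Fin.cons i v.2⟩

/-- The word consisting of the single letter `i`. -/
def letterWord {b : ℕ} (i : Fin b) : BWord b := ⟨0, fun _ => i⟩

/-- Here `none` stands for the root weight of a branch and `some v` for its subtree; injectivity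
lets independence pass to this reindexing. -/
lemma injective_letterWord_consWord (b : ℕ) :
    Function.Injective (fun p : Fin b × Option (BWord b) =>
      p.2.elim (letterWord p.1) (consWord p.1)) := by
  rintro ⟨i, _ | ⟨k, v⟩⟩ ⟨i', _ | ⟨k', v'⟩⟩ h
  · simp only [Option.elim, letterWord, Sigma.mk.injEq, heq_eq_eq, true_and] at h
    simpa using congrFun h 0
  · simp [letterWord, consWord] at h
  · simp [letterWord, consWord] at h
  · simp only [Option.elim, consWord, Sigma.mk.injEq, add_left_inj] at h
    obtain ⟨rfl, h⟩ := h
    rw [heq_eq_eq, Fin.cons_inj] at h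
    simp [h.1, h.2]

lemma wordPrefix_cons_zero {b n : ℕ} (i : Fin b) (j : Fin n → Fin b) :
    wordPrefix (Fin.cons i j : Fin (n + 1) → Fin b) 0 = letterWord i := by
  unfold wordPrefix letterWord
  congr 1
  funext x
  have : Fin.castLE (0 : Fin (n + 1)).isLt x = 0 := by
    change Fin 1 at x
    rw [Fin.fin_one_eq_zero x]; rfl
  rw [this, Fin.cons_zero]

lemma wordPrefix_cons_succ {b n : ℕ} (i : Fin b) (j : Fin n → Fin b) (k : Fin n) :
    wordPrefix (Fin.cons i j : Fin (n + 1) → Fin b) k.succ = consWord i (wordPrefix j k) := by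
  unfold wordPrefix consWord
  congr 1
  funext x
  refine Fin.cases ?_ (fun y => ?_) x
  · rfl
  · rfl

section

variable {Ω : Type*}

lemma cascadeMass_comp {Ω' : Type*} (b : ℕ) (W : BWord b → Ω → ℝ) (g : Ω' → Ω) (n : ℕ) (ω : Ω') :
    cascadeMass b (fun v x => W v (g x)) n ω = cascadeMass b W n (g ω) := rfl

lemma cascadeMass_zero (b : ℕ) (W : BWord b → Ω → ℝ) (ω : Ω) : cascadeMass b W 0 ω = 1 := by
  simp [cascadeMass]

lemma cascadeMass_succ (b : ℕ) (W : BWord b → Ω → ℝ) (n : ℕ) (ω : Ω) :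
    cascadeMass b W (n + 1) ω = ∑ i : Fin b, W (letterWord i) ω / b *
      cascadeMass b (fun v => W (consWord i v)) n ω := by
  unfold cascadeMass
  rw [← (Fin.consEquiv fun _ : Fin (n + 1) => Fin b).sum_comp, Fintype.sum_prod_type,
    Finset.mul_sum]
  refine Finset.sum_congr rfl fun i _ => ?_
  have hcons (j : Fin n → Fin b) :
      (Fin.consEquiv fun _ : Fin (n + 1) => Fin b) (i, j) = Fin.cons i j := rfl
  simp only [hcons, Fin.prod_univ_succ, wordPrefix_cons_zero, wordPrefix_cons_succ]
  rw [← Finset.mul_sum, pow_succ, mul_inv]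
  ring

lemma cascadeMass_nonneg {b : ℕ} {W : BWord b → Ω → ℝ} {ω : Ω}
    (hW : ∀ v, W v ω = 0 ∨ W v ω = b) (n : ℕ) : 0 ≤ cascadeMass b W n ω := by
  refine mul_nonneg (by positivity) (Finset.sum_nonneg fun j _ => Finset.prod_nonneg fun k _ => ?_)
  rcases hW (wordPrefix j k) with h | h <;> rw [h]
  positivity

lemma cascadeMass_le {b : ℕ} (hb : b ≠ 0) {W : BWord b → Ω → ℝ} {ω : Ω}
    (hW : ∀ v, W v ω = 0 ∨ W v ω = b) (n : ℕ) : cascadeMass b W n ω ≤ (b : ℝ) ^ n := by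
  have hb' : (b : ℝ) ≠ 0 := by exact_mod_cast hb
  have h : ∑ j : Fin n → Fin b, ∏ k : Fin n, W (wordPrefix j k) ω ≤
      ∑ j : Fin n → Fin b, ∏ k : Fin n, (b : ℝ) := by
    gcongr with j _ k _
    · intro k _
      rcases hW (wordPrefix j k) with h | h <;> rw [h]
      positivity
    · rcases hW (wordPrefix j k) with h | h <;> rw [h]
      positivity
  calc cascadeMass b W n ω ≤ ((b : ℝ) ^ n)⁻¹ * ∑ j : Fin n → Fin b, ∏ k : Fin n, (b : ℝ) := by
        unfold cascadeMass; gcongr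
    _ = (b : ℝ) ^ n := by simp [hb']

variable [MeasurableSpace Ω]

lemma measurable_cascadeMass {b : ℕ} {W : BWord b → Ω → ℝ} (hW : ∀ v, Measurable (W v)) (n : ℕ) :
    Measurable (cascadeMass b W n) := by
  unfold cascadeMass
  fun_prop

/-- A family of measurable independent totally critical weights, with values in `{0, b}`
everywhere. -/
structure IsTotallyCritical (P : Measure Ω) (b : ℕ) (W : BWord b → Ω → ℝ) : Prop where
  measurable : ∀ v, Measurable (W v)
  eq_zero_or_eq : ∀ v ω, W v ω = 0 ∨ W v ω = b
  integral_eq_one : ∀ v, ∫ ω, W v ω ∂P = 1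
  iIndepFun : iIndepFun W P

namespace IsTotallyCritical

variable {P : Measure Ω} {b : ℕ} {W : BWord b → Ω → ℝ}

lemma cons (h : IsTotallyCritical P b W) (i : Fin b) :
    IsTotallyCritical P b (fun v => W (consWord i v)) where
  measurable v := h.measurable _
  eq_zero_or_eq v := h.eq_zero_or_eq _
  integral_eq_one v := h.integral_eq_one _
  iIndepFun := h.iIndepFun.precomp (g := consWord i) fun v v' hv => by
    simpa using @injective_letterWord_consWord b (i, some v) (i, some v') hv

/-- The pairs formed by the weight of a letter and the mass of its subtree are independent. -/
lemma iIndepFun_pair (h : IsTotallyCritical P b W) (n : ℕ) :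
    ProbabilityTheory.iIndepFun (fun (i : Fin b) ω =>
      (W (letterWord i) ω, cascadeMass b (fun v => W (consWord i v)) n ω)) P := by
  have h1 := (h.iIndepFun.precomp (injective_letterWord_consWord b)).curry
    (X := fun i (o : Option (BWord b)) => W (o.elim (letterWord i) (consWord i))) (fun i o => h.measurable _)
  have h2 := h1.comp (fun _ x => (x none, cascadeMass b (fun v y => y (some v)) n x)) fun i =>
    (measurable_pi_apply none).prodMk
      (measurable_cascadeMass (fun v => measurable_pi_apply (some v)) n)
  have e (i : Fin b) (ω : Ω) : cascadeMass b (fun v => W (consWord i v)) n ω =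
      cascadeMass b (fun v y => y (some v)) n
        (fun o : Option (BWord b) => W (o.elim (letterWord i) (consWord i)) ω) :=
    cascadeMass_comp b (fun v y => y (some v))
      (fun ω (o : Option (BWord b)) => W (o.elim (letterWord i) (consWord i)) ω) n ω
  simp_rw [e]
  exact h2

/-- The weight of a letter is independent of the mass of its subtree. -/
lemma indepFun_letter (h : IsTotallyCritical P b W) (i : Fin b) (n : ℕ) :
    IndepFun (W (letterWord i)) (cascadeMass b (fun v => W (consWord i v)) n) P := by
  have h0 : ProbabilityTheory.iIndepFun (fun o : Option (BWord b) =>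
      W (o.elim (letterWord i) (consWord i))) P :=
    h.iIndepFun.precomp (g := fun o : Option (BWord b) => o.elim (letterWord i) (consWord i))
      fun o o' ho => by simpa using @injective_letterWord_consWord b (i, o) (i, o') ho
  have := h.iIndepFun.isProbabilityMeasure
  have h1 : IndepFun (W (letterWord i)) (fun ω v => W (consWord i v) ω) P := by
    refine IndepFun.indepFun_process (h.measurable _) (fun v => h.measurable _) fun J => ?_
    have h2 := h0.indepFun_finset {none} (J.map .some) (by simp) (fun o => h.measurable _)
    let φ : (({none} : Finset (Option (BWord b))) → ℝ) → ℝ :=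
      fun x => x ⟨none, Finset.mem_singleton_self none⟩
    let ψ : ((J.map .some : Finset (Option (BWord b))) → ℝ) → J → ℝ :=
      fun y v => y ⟨some v, Finset.mem_map_of_mem _ v.2⟩
    exact h2.comp (φ := φ) (ψ := ψ) (measurable_pi_apply _)
      (measurable_pi_lambda _ fun v => measurable_pi_apply _)
  exact h1.comp measurable_id (measurable_cascadeMass (fun v => measurable_pi_apply v) n)

end IsTotallyCritical

/-! ### Generating functions and moment bounds -/

namespace IsTotallyCritical

variable {P : Measure Ω} {b : ℕ} {W : BWord b → Ω → ℝ}

lemma integrable_comp_cascadeMass (h : IsTotallyCritical P b W) (hb : b ≠ 0) (n : ℕ) {f : ℝ → ℝ}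
    (hf : Measurable f) {C : ℝ} (hC : ∀ y, 0 ≤ y → y ≤ (b : ℝ) ^ n → |f y| ≤ C) :
    Integrable (fun ω => f (cascadeMass b W n ω)) P := by
  have := h.iIndepFun.isProbabilityMeasure
  exact Integrable.of_bound (hf.comp (measurable_cascadeMass h.measurable n)).aestronglyMeasurable C
    (ae_of_all _ fun ω => hC _ (cascadeMass_nonneg (h.eq_zero_or_eq · ω) n)
      (cascadeMass_le hb (h.eq_zero_or_eq · ω) n))

lemma integrable_cascadeMass (h : IsTotallyCritical P b W) (hb : b ≠ 0) (n : ℕ) :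
    Integrable (cascadeMass b W n) P :=
  h.integrable_comp_cascadeMass hb n (f := id) measurable_id (C := (b : ℝ) ^ n)
    fun y h0 h1 => by rwa [id, abs_of_nonneg h0]

lemma integrable_cascadeMass_rpow (h : IsTotallyCritical P b W) (hb : b ≠ 0) (n : ℕ) {q : ℝ}
    (hq : 0 ≤ q) : Integrable (fun ω => cascadeMass b W n ω ^ q) P :=
  h.integrable_comp_cascadeMass hb n (f := fun y => y ^ q) (by fun_prop) (C := ((b : ℝ) ^ n) ^ q)
    fun y h0 h1 => by rw [abs_of_nonneg (by positivity)]; gcongr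

lemma integrable_rpow_cascadeMass (h : IsTotallyCritical P b W) (hb : b ≠ 0) (n : ℕ) {s : ℝ}
    (hs : 0 ≤ s) : Integrable (fun ω => s ^ cascadeMass b W n ω) P :=
  h.integrable_comp_cascadeMass hb n (f := fun y => s ^ y) (by fun_prop)
    (C := (s + 1) ^ ((b : ℝ) ^ n)) fun y h0 h1 => by
      rw [abs_of_nonneg (by positivity)]
      calc s ^ y ≤ (s + 1) ^ y := by gcongr; linarith
        _ ≤ _ := by gcongr; linarith

lemma integral_letter_mul (h : IsTotallyCritical P b W) (i : Fin b) (n : ℕ) {f : ℝ → ℝ}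
    (hf : Measurable f) :
    ∫ ω, W (letterWord i) ω * f (cascadeMass b (fun v => W (consWord i v)) n ω) ∂P =
      ∫ ω, f (cascadeMass b (fun v => W (consWord i v)) n ω) ∂P := by
  have hc := measurable_cascadeMass (h.cons i).measurable n
  have := ((h.indepFun_letter i n).comp measurable_id hf).integral_fun_mul_eq_mul_integral
    (h.measurable _).aestronglyMeasurable (hf.comp hc).aestronglyMeasurable
  simpa [h.integral_eq_one] using this

lemma integrable_letter_mul (h : IsTotallyCritical P b W) (i : Fin b) {X : Ω → ℝ}
    (hX : Integrable X P) : Integrable (fun ω => W (letterWord i) ω * X ω) P := by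
  refine hX.bdd_mul (c := b) (h.measurable _).aestronglyMeasurable (ae_of_all _ fun ω => ?_)
  rcases h.eq_zero_or_eq (letterWord i) ω with h | h <;> simp [h]

lemma integral_cascadeMass (h : IsTotallyCritical P b W) (hb : b ≠ 0) (n : ℕ) :
    ∫ ω, cascadeMass b W n ω ∂P = 1 := by
  have := h.iIndepFun.isProbabilityMeasure
  induction n generalizing W with
  | zero => simp [cascadeMass_zero]
  | succ n ih =>
    have hb' : (b : ℝ) ≠ 0 := by exact_mod_cast hb
    simp_rw [cascadeMass_succ, div_mul_eq_mul_div]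
    rw [integral_finsetSum _ fun i _ =>
      (h.integrable_letter_mul i ((h.cons i).integrable_cascadeMass hb n)).div_const _]
    have (i : Fin b) : ∫ ω, W (letterWord i) ω * cascadeMass b (fun v => W (consWord i v)) n ω ∂P
        = 1 := (h.integral_letter_mul i n measurable_id).trans (ih (h.cons i))
    simp [integral_div, this, hb']

/-- The generating functions of the cascade are the iterates of `genStep`. -/
lemma integral_rpow_cascadeMass (h : IsTotallyCritical P b W) (hb : b ≠ 0) {s : ℝ} (hs : 0 ≤ s)
    (n : ℕ) : ∫ ω, s ^ cascadeMass b W n ω ∂P = (genStep b)^[n] s := by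
  have := h.iIndepFun.isProbabilityMeasure
  induction n generalizing W with
  | zero => simp [cascadeMass_zero]
  | succ n ih =>
    have hb' : (b : ℝ) ≠ 0 := by exact_mod_cast hb
    rw [Function.iterate_succ_apply']
    -- For `w ∈ {0, b}`, `s ^ (w / b * y) = 1 + w * (s ^ y - 1) / b`. This is affine in `w`, so only
    -- the mean of the weight enters.
    have hprod (ω : Ω) : s ^ cascadeMass b W (n + 1) ω = ∏ i : Fin b,
        (1 + (W (letterWord i) ω * (s ^ cascadeMass b (fun v => W (consWord i v)) n ω - 1)) / b) := by
      rw [cascadeMass_succ, Real.rpow_sum_of_nonneg hs]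
      · refine Finset.prod_congr rfl fun i _ => ?_
        rcases h.eq_zero_or_eq (letterWord i) ω with h | h <;> simp [h, hb']
      · intro i _
        refine mul_nonneg ?_ (cascadeMass_nonneg ((h.cons i).eq_zero_or_eq · ω) n)
        rcases h.eq_zero_or_eq (letterWord i) ω with h | h <;> simp [h, hb']
    have hind := (h.iIndepFun_pair n).comp (fun _ x => 1 + (x.1 * (s ^ x.2 - 1)) / b)
      (fun _ => by fun_prop)
    simp_rw [hprod]
    have hX (i : Fin b) : Integrable (fun ω =>
        s ^ cascadeMass b (fun v => W (consWord i v)) n ω - 1) P :=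
      ((h.cons i).integrable_rpow_cascadeMass hb n hs).sub (integrable_const 1)
    have hfac (i : Fin b) : ∫ ω, (1 + (W (letterWord i) ω *
        (s ^ cascadeMass b (fun v => W (consWord i v)) n ω - 1)) / b) ∂P =
        1 + ((genStep b)^[n] s - 1) / b := by
      rw [integral_add (integrable_const 1) ((h.integrable_letter_mul i (hX i)).div_const _),
        integral_div, h.integral_letter_mul i n (f := fun y => s ^ y - 1) (by fun_prop),
        integral_sub ((h.cons i).integrable_rpow_cascadeMass hb n hs) (integrable_const 1),
        ih (h.cons i)]
      simp
    have key := hind.integral_fun_prod_eq_prod_integral fun i => by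
      refine (Measurable.comp (by fun_prop) ((h.measurable _).prodMk
        (measurable_cascadeMass (h.cons i).measurable n))).aestronglyMeasurable
    refine key.trans ?_
    simp only [Function.comp_def, hfac, Finset.prod_const, Finset.card_univ, Fintype.card_fin,
      genStep]

lemma exists_integral_rpow_le (h : IsTotallyCritical P b W) (hb : 2 ≤ b) {q : ℝ} (hq : 1 ≤ q) :
    ∃ C, ∀ n : ℕ, 1 ≤ n → ∫ ω, cascadeMass b W n ω ^ q ∂P ≤ C * (n : ℝ) ^ (q - 1) := by
  have := h.iIndepFun.isProbabilityMeasure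
  have hb0 : b ≠ 0 := by omega
  obtain ⟨C, hC, hCy⟩ := exists_rpow_le_mul_exp_sub_one hq
  refine ⟨C * (4 * 8 ^ (q - 1)), fun n hn => ?_⟩
  have hn' : (1 : ℝ) ≤ n := by exact_mod_cast hn
  -- The largest `t` that `iterate_genStep_exp_le` allows.
  set t : ℝ := (8 * n)⁻¹ with ht
  have ht0 : 0 < t := by positivity
  have htn : 8 * (n * t) = 1 := by rw [ht]; field_simp
  have hint := h.integrable_rpow_cascadeMass hb0 n (Real.exp_pos t).le
  have hpt (ω : Ω) : t ^ q * cascadeMass b W n ω ^ q ≤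
      C * (Real.exp t ^ cascadeMass b W n ω - 1) := by
    have h0 := cascadeMass_nonneg (h.eq_zero_or_eq · ω) n
    rw [← Real.mul_rpow ht0.le h0, ← Real.exp_mul]
    exact hCy _ (mul_nonneg ht0.le h0)
  have h1 := integral_mono ((h.integrable_cascadeMass_rpow hb0 n (by linarith)).const_mul _)
    ((hint.sub (integrable_const 1)).const_mul C) hpt
  simp only [Pi.sub_apply] at h1
  rw [integral_const_mul, integral_const_mul, integral_sub hint (integrable_const 1),
    h.integral_rpow_cascadeMass hb0 (Real.exp_pos t).le] at h1
  have h2 := iterate_genStep_exp_le hb ht0.le htn.le (by nlinarith)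
  have h3 : t ^ q * ∫ ω, cascadeMass b W n ω ^ q ∂P ≤ C * (4 * t) := by
    refine h1.trans ?_
    simp only [integral_const, probReal_univ, smul_eq_mul, mul_one]
    gcongr
    linarith
  have h4 : C * (4 * 8 ^ (q - 1)) * (n : ℝ) ^ (q - 1) * t ^ q = C * (4 * t) := by
    have : ((8 : ℝ) * n) ^ (q - 1) * t ^ q = t := by
      rw [ht, Real.inv_rpow (by positivity), ← Real.rpow_neg (by positivity),
        ← Real.rpow_add (by positivity), ← Real.rpow_neg_one]
      ring_nf
    rw [Real.mul_rpow (by norm_num) (by positivity)] at this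
    linear_combination (C * 4) * this
  refine le_of_mul_le_mul_right ?_ (Real.rpow_pos_of_pos ht0 q)
  linarith

lemma exists_le_integral_rpow (h : IsTotallyCritical P b W) (hb : 2 ≤ b) {q : ℝ} (hq : 1 ≤ q) :
    ∃ c > 0, ∀ n : ℕ, 1 ≤ n → c * (n : ℝ) ^ (q - 1) ≤ ∫ ω, cascadeMass b W n ω ^ q ∂P := by
  have := h.iIndepFun.isProbabilityMeasure
  have hb0 : b ≠ 0 := by omega
  have hb' : (0 : ℝ) < b := by positivity
  refine ⟨2⁻¹ * ((2 * b ^ 2 : ℝ)⁻¹) ^ (q - 1), by positivity, fun n hn => ?_⟩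
  have hn' : (1 : ℝ) ≤ n := by exact_mod_cast hn
  -- Chosen so that the survival term takes at most half of the mean `1`.
  set l : ℝ := (2 * b ^ 2 : ℝ)⁻¹ * n with hl
  have hl0 : 0 < l := by positivity
  have hint := h.integrable_rpow_cascadeMass hb0 n le_rfl
  have hintq := h.integrable_cascadeMass_rpow hb0 n (by linarith : 0 ≤ q)
  have hint1 : Integrable (fun ω => 1 - (0 : ℝ) ^ cascadeMass b W n ω) P :=
    (integrable_const 1).sub hint
  have h1 := integral_mono (h.integrable_cascadeMass hb0 n)
    ((hintq.const_mul (l ^ (1 - q))).add (hint1.const_mul l)) fun ω =>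
      le_rpow_add_mul_one_sub_zero_rpow hq hl0 (cascadeMass_nonneg (h.eq_zero_or_eq · ω) n)
  rw [h.integral_cascadeMass hb0] at h1
  simp only [Pi.add_apply] at h1
  rw [integral_add (hintq.const_mul _) (hint1.const_mul l), integral_const_mul,
    integral_const_mul, integral_sub (integrable_const 1) hint, h.integral_rpow_cascadeMass hb0 le_rfl] at h1
  simp only [integral_const, probReal_univ, smul_eq_mul, mul_one] at h1
  obtain ⟨-, h2, h3⟩ := iterate_genStep_zero hb n
  have h4 : l * (1 - (genStep b)^[n] 0) ≤ 2⁻¹ := by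
    have : (1 - (genStep b)^[n] 0) * n ≤ (b : ℝ) ^ 2 := by nlinarith [sq_nonneg (b : ℝ)]
    calc l * (1 - (genStep b)^[n] 0)
        = (2 * b ^ 2 : ℝ)⁻¹ * ((1 - (genStep b)^[n] 0) * n) := by rw [hl]; ring
      _ ≤ (2 * b ^ 2 : ℝ)⁻¹ * b ^ 2 := by gcongr
      _ = 2⁻¹ := by field_simp
  rw [mul_assoc, ← Real.mul_rpow (by positivity) (by positivity), ← hl]
  have h5 : l ^ (q - 1) * l ^ (1 - q) = 1 := by rw [← Real.rpow_add hl0]; simp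
  have h6 : (2⁻¹ : ℝ) ≤ l ^ (1 - q) * ∫ ω, cascadeMass b W n ω ^ q ∂P := by linarith
  calc 2⁻¹ * l ^ (q - 1) ≤ (l ^ (1 - q) * ∫ ω, cascadeMass b W n ω ^ q ∂P) * l ^ (q - 1) := by
        gcongr
    _ = _ := by linear_combination (∫ ω, cascadeMass b W n ω ^ q ∂P) * h5

end IsTotallyCritical

/-! ### Reduction to weights valued in {0, b} everywhere, and conclusion -/

lemma ae_totallyCriticalLaw (b : ℕ) : ∀ᵐ x : ℝ ∂totallyCriticalLaw b, x = 0 ∨ x = b := by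
  have hs : MeasurableSet {x : ℝ | x = 0 ∨ x = b} :=
    (measurableSet_singleton 0).union (measurableSet_singleton (b : ℝ))
  unfold totallyCriticalLaw
  rw [ae_add_measure_iff]
  refine ⟨Measure.ae_smul_measure ?_ _, Measure.ae_smul_measure ?_ _⟩ <;>
    exact (ae_dirac_iff hs).2 (by simp)

lemma integral_totallyCriticalLaw {b : ℕ} (hb : b ≠ 0) : ∫ x, x ∂totallyCriticalLaw b = 1 := by
  have hb' : (b : ℝ) ≠ 0 := by exact_mod_cast hb
  unfold totallyCriticalLaw
  rw [integral_add_measure, integral_smul_measure, integral_smul_measure, integral_dirac,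
    integral_dirac, ENNReal.toReal_ofReal (by positivity)]
  · simp [hb']
  · exact (integrable_dirac (by simp)).smul_measure (by simp)
  · exact (integrable_dirac (by simp)).smul_measure (by simp)

/-- A cascade of independent totally critical weights agrees almost surely with one whose weights
are measurable and take only the values `0` and `b`. -/
lemma exists_isTotallyCritical_ae_eq {P : Measure Ω} {b : ℕ} (hb : b ≠ 0) {W : BWord b → Ω → ℝ}
    (hlaw : ∀ v, HasLaw (W v) (totallyCriticalLaw b) P) (hindep : iIndepFun W P) :
    ∃ W' : BWord b → Ω → ℝ, IsTotallyCritical P b W' ∧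
      ∀ᵐ ω ∂P, ∀ n, cascadeMass b W n ω = cascadeMass b W' n ω := by
  -- `g` fixes `0` and `b` and sends every other value to `0`, so composing with it changes the
  -- weights only on a null set.
  let g : ℝ → ℝ := ({(b : ℝ)} : Set ℝ).indicator fun _ => b
  have hg : Measurable g := measurable_const.indicator (measurableSet_singleton _)
  let W' : BWord b → Ω → ℝ := fun v => g ∘ (hlaw v).aemeasurable.mk
  have hW (v) : W v =ᵐ[P] W' v := by
    have h1 : ∀ᵐ ω ∂P, W v ω = 0 ∨ W v ω = b := by
      refine ae_of_ae_map (p := fun x => x = 0 ∨ x = b) (hlaw v).aemeasurable ?_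
      rw [(hlaw v).map_eq]
      exact ae_totallyCriticalLaw b
    filter_upwards [h1, (hlaw v).aemeasurable.ae_eq_mk] with ω h1 h2
    have hb' : (0 : ℝ) ≠ b := by exact_mod_cast hb.symm
    simp only [W', Function.comp_apply, ← h2]
    rcases h1 with h | h <;> simp [h, g, hb']
  refine ⟨W', ⟨fun v => hg.comp (hlaw v).aemeasurable.measurable_mk, fun v ω => ?_, fun v => ?_,
    (iIndepFun_congr hW).1 hindep⟩, ?_⟩
  · by_cases h : (hlaw v).aemeasurable.mk (W v) ω = b <;> simp [W', g, h]
  · rw [← integral_congr_ae (hW v), (hlaw v).integral_eq, integral_totallyCriticalLaw hb]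
  · filter_upwards [ae_all_iff.2 hW] with ω h n
    simp [cascadeMass, h]

end

theorem theorem1 {Ω : Type*} [MeasurableSpace Ω] (P : Measure Ω) [IsProbabilityMeasure P]
    (b : ℕ) (hb : 2 ≤ b) (W : BWord b → Ω → ℝ)
    (hlaw : ∀ v, HasLaw (W v) (totallyCriticalLaw b) P)
    (hindep : iIndepFun W P)
    (q : ℝ) (hq : 1 < q) :
    (∀ n : ℕ, Integrable (fun ω => cascadeMass b W n ω ^ q) P) ∧
      Tendsto (fun n : ℕ => Real.log (∫ ω, cascadeMass b W n ω ^ q ∂P) / Real.log (n : ℝ))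
        atTop (𝓝 (q - 1)) := by
  obtain ⟨W', h, hWW'⟩ := exists_isTotallyCritical_ae_eq (by omega) hlaw hindep
  have hae (n : ℕ) : (fun ω => cascadeMass b W n ω ^ q) =ᵐ[P] fun ω => cascadeMass b W' n ω ^ q := by
    filter_upwards [hWW'] with ω hω
    rw [hω n]
  refine ⟨fun n => (h.integrable_cascadeMass_rpow (by omega) n (by linarith)).congr (hae n).symm, ?_⟩
  simp_rw [fun n => integral_congr_ae (hae n)]
  obtain ⟨C, hC⟩ := h.exists_integral_rpow_le hb hq.le
  obtain ⟨c, hc, hcn⟩ := h.exists_le_integral_rpow hb hq.le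
  exact tendsto_log_div_log hc hcn hC
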